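/- **Language.** Fix a set of proposition letters $p,q,\dots$ and disjoint sets $\mathcal F,\mathcal G$ of connectives; each $k\in\mathcal F\cup\mathcal G$ has an arity $n_k\in\mathbb N$ and an order-type $\varepsilon_k\in\{1,\partial\}^{n_k}$. Formulas are $$\varphi::=p\mid\bot\mid\top\mid\varphi\wedge\varphi\mid\varphi\vee\varphi\mid f(\varphi_1,\dots,\varphi_{n_f})\mid g(\varphi_1,\dots,\varphi_{n_g})\qquad(f\in\mathcal F,\ g\in\mathcal G).$$ Multiply $1,\partial$ like the integers $1,-1$ and write $1^\partial=\partial$, $\partial^\partial=1$. Each $f\in\mathcal F$ has residuals $f^\sharp_i$ ($1\le i\le n_f$) of arity $n_f$ with $\varepsilon_{f^\sharp_i}(i)=\varepsilon_f(i)$ and $\varepsilon_{f^\sharp_i}(j)=\varepsilon_f(j)\cdot\varepsilon_f(i)^\partial$ for $j\ne i$; residuals $g^\flat_i$ of $g\in\mathcal G$ are defined in the same way from $\varepsilon_g$. $\mathcal F^*$ consists of $\mathcal F$, the $f^\sharp_i$ with $\varepsilon_f(i)=\partial$ and the $g^\flat_i$ with $\varepsilon_g(i)=1$; $\mathcal G^*$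 consists of $\mathcal G$, the $f^\sharp_i$ with $\varepsilon_f(i)=1$ and the $g^\flat_i$ with $\varepsilon_g(i)=\partial$. **Structures.** Precedent structures $\Pi$ and succedent structures $\Sigma$ are given by $\Pi::=\varphi\mid\hat\top\mid\hat k(\overline\Upsilon)$ with $k\in\mathcal F^*$ and $\Sigma::=\varphi\mid\check\bot\mid\check k(\overline\Upsilon)$ with $k\in\mathcal G^*$, where $\Upsilon_j$ is of the same sort as the whole structure if $\varepsilon_k(j)=1$ and of the other sort if $\varepsilon_k(j)=\partial$. The structural connectives of $f^\sharp_i$, $g^\flat_i$ are called *residuals*. A sequent $\Pi\vdash\Sigma$ and an antisequent $\Pi\nvdash\Sigma$ consist of a precedent and a succedent structure. $X\vdash^1Y$ is $X\vdash Y$ and $X\vdash^\partial Y$ is $Y\vdash X$ (likewise for $\nvdash$); $\check\bot^1=\hat\top^\partial=\check\bot$, $\check\bot^\partial=\hat\top^1=\hat\top$. In the rules $\varphi,\psi$ are formulas, and $f,f_1,f_2\in\mathcal F$, $g,g_1,g_2\in\mathcal G$. **The calculus $\mathrm{D.LE}$** has the rules (premises $\Rightarrow$ conclusion): - $\Rightarrow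 p\vdash p$; cut: $\Pi\vdash\varphi,\ \varphi\vdash\Sigma\Rightarrow\Pi\vdash\Sigma$; - display postulates, in both directions and for every coordinate $i$: $\hat f(\dots,\Upsilon_i,\dots)\vdash\Sigma\Leftrightarrow\Upsilon_i\vdash^{\varepsilon_f(i)}f^\sharp_i(\dots,\Sigma,\dots)$ and $\Pi\vdash\check g(\dots,\Upsilon_i,\dots)\Leftrightarrow g^\flat_i(\dots,\Pi,\dots)\vdash^{\varepsilon_g(i)}\Upsilon_i$ (structural $f^\sharp_i$, $g^\flat_i$; the other arguments are unchanged); - $\hat\top\vdash\Sigma\Rightarrow\Pi\vdash\Sigma$; $\ \Pi\vdash\check\bot\Rightarrow\Pi\vdash\Sigma$; $\ \hat\top\vdash\Sigma\Rightarrow\top\vdash\Sigma$; $\ \Rightarrow\hat\top\vdash\top$; $\ \Rightarrow\bot\vdash\check\bot$; $\ \Pi\vdash\check\bot\Rightarrow\Pi\vdash\bot$; - $\varphi_k\vdash\Sigma\Rightarrow\varphi_1\wedge\varphi_2\vdash\Sigma$ and $\Pi\vdash\varphi_k\Rightarrow\Pi\vdash\varphi_1\vee\varphi_2$ ($k=1,2$);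 $\ \Pi\vdash\varphi,\ \Pi\vdash\psi\Rightarrow\Pi\vdash\varphi\wedge\psi$; $\ \varphi\vdash\Sigma,\ \psi\vdash\Sigma\Rightarrow\varphi\vee\psi\vdash\Sigma$; - $(\varphi_i\vdash^{\varepsilon_g(i)}\Upsilon_i)_{i\le n_g}\Rightarrow g(\overline\varphi)\vdash\check g(\overline\Upsilon)$; $\ (\Upsilon_i\vdash^{\varepsilon_f(i)}\varphi_i)_{i\le n_f}\Rightarrow\hat f(\overline\Upsilon)\vdash f(\overline\varphi)$; $\ \hat f(\overline\varphi)\vdash\Sigma\Rightarrow f(\overline\varphi)\vdash\Sigma$; $\ \Pi\vdash\check g(\overline\varphi)\Rightarrow\Pi\vdash g(\overline\varphi)$. **Branching.** The signed generation tree of a structure in precedent (succedent) position, continued into its formulas, has root sign $+$ ($-$); a child in a coordinate of order-type $1$ inherits the sign of its parent, one in a coordinate of order-type $\partial$ gets the opposite sign. The structure is *branching* if this tree has a $+\vee$ or $-\wedge$ node all of whose proper ancestors are labelled $+f,+\hat f,-g$ or $-\check g$ with $f\in\mathcal F$, $g\in\mathcal G$. **The refutation calculus $\mathrm{D.LE}^r$.**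 Write $\mathrm B_f(\overline\Upsilon)$ for the family of premises $\Upsilon_i\nvdash^{\varepsilon_f(i)}\check\bot^{\varepsilon_f(i)}$, $1\le i\le n_f$, and $\mathrm T_g(\overline\Upsilon)$ for the family $\hat\top^{\varepsilon_g(i)}\nvdash^{\varepsilon_g(i)}\Upsilon_i$, $1\le i\le n_g$. The rules are: - axioms $\hat\top\nvdash\check\bot$; $p\nvdash\check\bot$; $\hat\top\nvdash q$; $p\nvdash q$ for $p\ne q$; $g(\overline\varphi)\nvdash\check\bot$; $g(\overline\varphi)\nvdash p$; $p\nvdash f(\overline\varphi)$; $\hat\top\nvdash f(\overline\varphi)$; $g(\overline\psi)\nvdash f(\overline\varphi)$; - the display rules above with $\nvdash$ in place of $\vdash$; - if the conclusion contains no residuals: $\mathrm B_f(\overline\Upsilon)\Rightarrow\hat f(\overline\Upsilon)\nvdash\check\bot$; $\ \mathrm B_f(\overline\Upsilon)\Rightarrow\hat f(\overline\Upsilon)\nvdash p$; $\ \mathrm T_g(\overline\Upsilon)\Rightarrow\hat\top\nvdash\check g(\overline\Upsilon)$; $\ \mathrm T_g(\overline\Upsilon)\Rightarrow p\nvdash\check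 g(\overline\Upsilon)$; $\ \mathrm B_f(\overline\Upsilon),\mathrm T_g(\overline{\Upsilon'})\Rightarrow\hat f(\overline\Upsilon)\nvdash\check g(\overline{\Upsilon'})$; $\ \mathrm B_f(\overline\Upsilon),\ \Upsilon_j\nvdash^{\varepsilon_f(j)}\varphi_j\Rightarrow\hat f(\overline\Upsilon)\nvdash f(\overline\varphi)$ for any one $j$; $\ \mathrm T_g(\overline\Upsilon),\ \varphi_j\nvdash^{\varepsilon_g(j)}\Upsilon_j\Rightarrow g(\overline\varphi)\nvdash\check g(\overline\Upsilon)$ for any one $j$; $\ \mathrm B_{f_1}(\overline\Upsilon)\Rightarrow\hat f_1(\overline\Upsilon)\nvdash f_2(\overline\varphi)$ if $f_1\ne f_2$; $\ \mathrm T_{g_2}(\overline\Upsilon)\Rightarrow g_1(\overline\varphi)\nvdash\check g_2(\overline\Upsilon)$ if $g_1\ne g_2$; - $\hat f(\overline\varphi)\nvdash\Sigma\Rightarrow f(\overline\varphi)\nvdash\Sigma$; $\ \Pi\nvdash\check g(\overline\varphi)\Rightarrow\Pi\nvdash g(\overline\varphi)$; $\ \hat\top\nvdash\Sigma\Rightarrow\top\nvdash\Sigma$;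 $\ \Pi\nvdash\check\bot\Rightarrow\Pi\nvdash\bot$; $\ \varphi_k\nvdash\Sigma\Rightarrow\varphi_1\vee\varphi_2\nvdash\Sigma$; $\ \Pi\nvdash\varphi_k\Rightarrow\Pi\nvdash\varphi_1\wedge\varphi_2$ ($k=1,2$); - $\wedge_L$: if $\Sigma$ (in succedent position) is not branching and contains no residuals, infer $\varphi\wedge\psi\nvdash\Sigma$ from $\varphi\nvdash\Sigma$, $\psi\nvdash\Sigma$ and all antisequents $\varphi\wedge\psi\nvdash\Sigma'$ where $\Sigma'$ results from $\Sigma$ by replacing one occurrence of a substructure $A\wedge B$ in precedent position by $A$ or by $B$, or one occurrence of a substructure $C\vee D$ in succedent position by $C$ or by $D$; - $\vee_R$: if $\Pi$ (in precedent position) is not branching and contains no residuals, infer $\Pi\nvdash\varphi\vee\psi$ from $\Pi\nvdash\varphi$, $\Pi\nvdash\psi$ and all antisequents $\Pi'\nvdash\varphi\vee\psi$ where $\Pi'$ results from $\Pi$ by such a replacement. **Theorem.** For every such language: if a sequent $\Pi\vdash\Sigma$ contains no residuals and is not derivable in $\mathrm{D.LE}$, then the antisequent $\Pi\nvdash\Sigma$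 is derivable in $\mathrm{D.LE}^r$. -/

import Mathlib

namespace LEDisplay

/-- The two-element set used both for order-types (`pos` is `1`, `neg` is `∂`) and for signs or
positions in a sequent (`pos` is `+`, precedent; `neg` is `-`, succedent). -/
inductive Sgn : Type
  | pos
  | neg

/-- The opposite sign. -/
def Sgn.dual : Sgn → Sgn
  | .pos => .neg
  | .neg => .pos

/-- The product of signs, as for the integers `1` and `-1`. -/
def Sgn.mul : Sgn → Sgn → Sgn
  | .pos, t => t
  | .neg, t => t.dual

/-- The parameters of an LE-language: proposition letters, two disjoint families `F` and `G` of
connectives (two separate types), their arities, and their order-types. -/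
structure Sig where
  AtProp : Type*
  F : Type*
  G : Type*
  arF : F → ℕ
  arG : G → ℕ
  epsF : (f : F) → Fin (arF f) → Sgn
  epsG : (g : G) → Fin (arG g) → Sgn

/-- Formulas of the LE-language. -/
inductive Fm (L : Sig) : Type _
  | atom (p : L.AtProp) : Fm L
  | bot : Fm L
  | top : Fm L
  | and (A B : Fm L) : Fm L
  | or (A B : Fm L) : Fm L
  | opF (f : L.F) (a : Fin (L.arF f) → Fm L) : Fm L
  | opG (g : L.G) (a : Fin (L.arG g) → Fm L) : Fm L

/-- Order-type of the residual of `f` in coordinate `i`. -/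
def Sig.epsSharp (L : Sig) (f : L.F) (i j : Fin (L.arF f)) : Sgn :=
  if j = i then L.epsF f i else (L.epsF f j).mul (L.epsF f i).dual

/-- Order-type of the residual of `g` in coordinate `i`. -/
def Sig.epsFlat (L : Sig) (g : L.G) (i j : Fin (L.arG g)) : Sgn :=
  if j = i then L.epsG g i else (L.epsG g j).mul (L.epsG g i).dual

/-- Structures, before sorting into precedent and succedent ones (see `Str.IsAt`): formulas, the
structural constants, the structural connectives of `f ∈ F` and `g ∈ G`, and the structural
connectives of their residuals in each coordinate. -/
inductive Str (L : Sig) : Type _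
  | fm (A : Fm L) : Str L
  | hatTop : Str L
  | checkBot : Str L
  | opF (f : L.F) (a : Fin (L.arF f) → Str L) : Str L
  | opG (g : L.G) (a : Fin (L.arG g) → Str L) : Str L
  | sharp (f : L.F) (i : Fin (L.arF f)) (a : Fin (L.arF f) → Str L) : Str L
  | flat (g : L.G) (i : Fin (L.arG g)) (a : Fin (L.arG g) → Str L) : Str L

variable {L : Sig}

/-- `X.IsAt .pos`: `X` is a precedent structure; `X.IsAt .neg`: `X` is a succedent structure.
The residual of `f` in coordinate `i` is a succedent (`G`-type) connective if the order-type of `f`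
at `i` is `1`, and a precedent (`F`-type) one otherwise; dually for the residuals of `g`. -/
def Str.IsAt : Sgn → Str L → Prop
  | _, .fm _ => True
  | s, .hatTop => s = .pos
  | s, .checkBot => s = .neg
  | s, .opF f a => s = .pos ∧ ∀ j, (a j).IsAt (s.mul (L.epsF f j))
  | s, .opG g a => s = .neg ∧ ∀ j, (a j).IsAt (s.mul (L.epsG g j))
  | s, .sharp f i a => s = (L.epsF f i).dual ∧ ∀ j, (a j).IsAt (s.mul (L.epsSharp f i j))
  | s, .flat g i a => s = L.epsG g i ∧ ∀ j, (a j).IsAt (s.mul (L.epsFlat g i j))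

/-- The structure contains no residual structural connectives. -/
def Str.ResFree : Str L → Prop
  | .fm _ => True
  | .hatTop => True
  | .checkBot => True
  | .opF _ a => ∀ j, (a j).ResFree
  | .opG _ a => ∀ j, (a j).ResFree
  | .sharp _ _ _ => False
  | .flat _ _ _ => False

/-- Sequents (and antisequents): a pair of structures. -/
structure Seq (L : Sig) where
  ant : Str L
  suc : Str L

/-- `dir ε X Y` is the sequent `X ⊢ Y` if `ε = 1`, and `Y ⊢ X` if `ε = ∂`. -/
def Seq.dir : Sgn → Str L → Str L → Seq L
  | .pos, X, Y => ⟨X, Y⟩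
  | .neg, X, Y => ⟨Y, X⟩

/-- The sequent consists of a precedent and a succedent structure. -/
def Seq.WellSorted (S : Seq L) : Prop := S.ant.IsAt .pos ∧ S.suc.IsAt .neg

/-- The sequent contains no residual structural connectives. -/
def Seq.ResFree (S : Seq L) : Prop := S.ant.ResFree ∧ S.suc.ResFree

/-- The structural falsum, raised to an order-type. -/
def botPow : Sgn → Str L
  | .pos => .checkBot
  | .neg => .hatTop

/-- The structural verum, raised to an order-type. -/
def topPow : Sgn → Str L
  | .pos => .hatTop
  | .neg => .checkBot

/-- Derivability in the display calculus D.LE. In the display postulates, `dir` covers the case of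
order-type `1` and that of order-type `∂` at once. Weakening has to say that the new structure is
of the right sort; all other rules preserve well-sortedness. -/
inductive DLE : Seq L → Prop
  | id (p : L.AtProp) : DLE ⟨.fm (.atom p), .fm (.atom p)⟩
  | cut {X Y : Str L} (A : Fm L) : DLE ⟨X, .fm A⟩ → DLE ⟨.fm A, Y⟩ → DLE ⟨X, Y⟩
  -- display postulates, in both directions
  | dispF {f : L.F} {a : Fin (L.arF f) → Str L} {Y : Str L} (i : Fin (L.arF f)) :
      DLE ⟨.opF f a, Y⟩ →
      DLE (Seq.dir (L.epsF f i) (a i) (.sharp f i (Function.update a i Y)))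
  | undispF {f : L.F} {i : Fin (L.arF f)} {X : Str L} {b : Fin (L.arF f) → Str L} :
      DLE (Seq.dir (L.epsF f i) X (.sharp f i b)) →
      DLE ⟨.opF f (Function.update b i X), b i⟩
  | dispG {g : L.G} {a : Fin (L.arG g) → Str L} {X : Str L} (i : Fin (L.arG g)) :
      DLE ⟨X, .opG g a⟩ →
      DLE (Seq.dir (L.epsG g i) (.flat g i (Function.update a i X)) (a i))
  | undispG {g : L.G} {i : Fin (L.arG g)} {Y : Str L} {b : Fin (L.arG g) → Str L} :
      DLE (Seq.dir (L.epsG g i) (.flat g i b) Y) →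
      DLE ⟨b i, .opG g (Function.update b i Y)⟩
  -- weakening
  | topW {X Y : Str L} : X.IsAt .pos → DLE ⟨.hatTop, Y⟩ → DLE ⟨X, Y⟩
  | botW {X Y : Str L} : Y.IsAt .neg → DLE ⟨X, .checkBot⟩ → DLE ⟨X, Y⟩
  -- lattice connectives
  | topL {Y : Str L} : DLE ⟨.hatTop, Y⟩ → DLE ⟨.fm .top, Y⟩
  | topR : DLE ⟨.hatTop, .fm .top⟩
  | botL : DLE ⟨.fm .bot, .checkBot⟩
  | botR {X : Str L} : DLE ⟨X, .checkBot⟩ → DLE ⟨X, .fm .bot⟩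
  | andL1 {A B : Fm L} {Y : Str L} : DLE ⟨.fm A, Y⟩ → DLE ⟨.fm (.and A B), Y⟩
  | andL2 {A B : Fm L} {Y : Str L} : DLE ⟨.fm B, Y⟩ → DLE ⟨.fm (.and A B), Y⟩
  | andR {X : Str L} {A B : Fm L} :
      DLE ⟨X, .fm A⟩ → DLE ⟨X, .fm B⟩ → DLE ⟨X, .fm (.and A B)⟩
  | orL {A B : Fm L} {Y : Str L} :
      DLE ⟨.fm A, Y⟩ → DLE ⟨.fm B, Y⟩ → DLE ⟨.fm (.or A B), Y⟩
  | orR1 {X : Str L} {A B : Fm L} : DLE ⟨X, .fm A⟩ → DLE ⟨X, .fm (.or A B)⟩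
  | orR2 {X : Str L} {A B : Fm L} : DLE ⟨X, .fm B⟩ → DLE ⟨X, .fm (.or A B)⟩
  -- connectives in F and G
  | gL {g : L.G} {A : Fin (L.arG g) → Fm L} {U : Fin (L.arG g) → Str L} :
      (∀ i, DLE (Seq.dir (L.epsG g i) (.fm (A i)) (U i))) →
      DLE ⟨.fm (.opG g A), .opG g U⟩
  | fR {f : L.F} {U : Fin (L.arF f) → Str L} {A : Fin (L.arF f) → Fm L} :
      (∀ i, DLE (Seq.dir (L.epsF f i) (U i) (.fm (A i)))) →
      DLE ⟨.opF f U, .fm (.opF f A)⟩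
  | fL {f : L.F} {A : Fin (L.arF f) → Fm L} {Y : Str L} :
      DLE ⟨.opF f (fun i => .fm (A i)), Y⟩ → DLE ⟨.fm (.opF f A), Y⟩
  | gR {g : L.G} {A : Fin (L.arG g) → Fm L} {X : Str L} :
      DLE ⟨X, .opG g (fun i => .fm (A i))⟩ → DLE ⟨X, .fm (.opG g A)⟩

/-- The signed generation tree of the formula with root sign `s` has a `+∨` or `-∧` node all of
whose proper ancestors are `+f` or `-g` nodes, with `f ∈ F` and `g ∈ G`. -/
def Fm.Branching : Sgn → Fm L → Prop
  | _, .atom _ => False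
  | _, .bot => False
  | _, .top => False
  | s, .and _ _ => s = .neg
  | s, .or _ _ => s = .pos
  | s, .opF f a => s = .pos ∧ ∃ i, (a i).Branching (s.mul (L.epsF f i))
  | s, .opG g a => s = .neg ∧ ∃ i, (a i).Branching (s.mul (L.epsG g i))

/-- The signed generation tree of the structure with root sign `s`, continued into the formulas,
has a `+∨` or `-∧` node all of whose proper ancestors are operational or structural `+f` or `-g`
nodes, with `f ∈ F` and `g ∈ G` (so no residuals). -/
def Str.Branching : Sgn → Str L → Prop
  | s, .fm A => A.Branching s
  | _, .hatTop => False
  | _, .checkBot => False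
  | s, .opF f a => s = .pos ∧ ∃ i, (a i).Branching (s.mul (L.epsF f i))
  | s, .opG g a => s = .neg ∧ ∃ i, (a i).Branching (s.mul (L.epsG g i))
  | _, .sharp _ _ _ => False
  | _, .flat _ _ _ => False

/-- `Repl t U V s X Y`: the structure `Y` results from the structure `X`, standing in position `s`,
by replacing one occurrence of the substructure `U` in position `t` by `V`. -/
inductive Repl (t : Sgn) (U V : Str L) : Sgn → Str L → Str L → Prop
  | here : Repl t U V t U V
  | opF {s : Sgn} {f : L.F} {a : Fin (L.arF f) → Str L} {Z : Str L} (i : Fin (L.arF f)) :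
      Repl t U V (s.mul (L.epsF f i)) (a i) Z →
      Repl t U V s (.opF f a) (.opF f (Function.update a i Z))
  | opG {s : Sgn} {g : L.G} {a : Fin (L.arG g) → Str L} {Z : Str L} (i : Fin (L.arG g)) :
      Repl t U V (s.mul (L.epsG g i)) (a i) Z →
      Repl t U V s (.opG g a) (.opG g (Function.update a i Z))
  | sharp {s : Sgn} {f : L.F} {k : Fin (L.arF f)} {a : Fin (L.arF f) → Str L} {Z : Str L}
      (i : Fin (L.arF f)) :
      Repl t U V (s.mul (L.epsSharp f k i)) (a i) Z →
      Repl t U V s (.sharp f k a) (.sharp f k (Function.update a i Z))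
  | flat {s : Sgn} {g : L.G} {k : Fin (L.arG g)} {a : Fin (L.arG g) → Str L} {Z : Str L}
      (i : Fin (L.arG g)) :
      Repl t U V (s.mul (L.epsFlat g k i)) (a i) Z →
      Repl t U V s (.flat g k a) (.flat g k (Function.update a i Z))

/-- Derivability in the refutation display calculus: `DLEr ⟨X, Y⟩` says that the antisequent
`X ⊬ Y` is derivable. -/
inductive DLEr : Seq L → Prop
  -- axioms
  | ax1 : DLEr ⟨.hatTop, .checkBot⟩
  | ax2 (p : L.AtProp) : DLEr ⟨.fm (.atom p), .checkBot⟩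
  | ax3 (q : L.AtProp) : DLEr ⟨.hatTop, .fm (.atom q)⟩
  | ax4 (p q : L.AtProp) : p ≠ q → DLEr ⟨.fm (.atom p), .fm (.atom q)⟩
  -- display rules, in both directions
  | dispF {f : L.F} {a : Fin (L.arF f) → Str L} {Y : Str L} (i : Fin (L.arF f)) :
      DLEr ⟨.opF f a, Y⟩ →
      DLEr (Seq.dir (L.epsF f i) (a i) (.sharp f i (Function.update a i Y)))
  | undispF {f : L.F} {i : Fin (L.arF f)} {X : Str L} {b : Fin (L.arF f) → Str L} :
      DLEr (Seq.dir (L.epsF f i) X (.sharp f i b)) →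
      DLEr ⟨.opF f (Function.update b i X), b i⟩
  | dispG {g : L.G} {a : Fin (L.arG g) → Str L} {X : Str L} (i : Fin (L.arG g)) :
      DLEr ⟨X, .opG g a⟩ →
      DLEr (Seq.dir (L.epsG g i) (.flat g i (Function.update a i X)) (a i))
  | undispG {g : L.G} {i : Fin (L.arG g)} {Y : Str L} {b : Fin (L.arG g) → Str L} :
      DLEr (Seq.dir (L.epsG g i) (.flat g i b) Y) →
      DLEr ⟨b i, .opG g (Function.update b i Y)⟩
  -- structural rules for F and G; the endsequents contain no residuals
  | fBot {f : L.F} {U : Fin (L.arF f) → Str L} :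
      Seq.ResFree ⟨.opF f U, .checkBot⟩ →
      (∀ i, DLEr (Seq.dir (L.epsF f i) (U i) (botPow (L.epsF f i)))) →
      DLEr ⟨.opF f U, .checkBot⟩
  | topG {g : L.G} {U : Fin (L.arG g) → Str L} :
      Seq.ResFree ⟨.hatTop, .opG g U⟩ →
      (∀ i, DLEr (Seq.dir (L.epsG g i) (topPow (L.epsG g i)) (U i))) →
      DLEr ⟨.hatTop, .opG g U⟩
  | fAtom {f : L.F} {U : Fin (L.arF f) → Str L} (p : L.AtProp) :
      Seq.ResFree ⟨.opF f U, .fm (.atom p)⟩ →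
      (∀ i, DLEr (Seq.dir (L.epsF f i) (U i) (botPow (L.epsF f i)))) →
      DLEr ⟨.opF f U, .fm (.atom p)⟩
  | atomG {g : L.G} {U : Fin (L.arG g) → Str L} (p : L.AtProp) :
      Seq.ResFree ⟨.fm (.atom p), .opG g U⟩ →
      (∀ i, DLEr (Seq.dir (L.epsG g i) (topPow (L.epsG g i)) (U i))) →
      DLEr ⟨.fm (.atom p), .opG g U⟩
  | fG {f : L.F} {g : L.G} {U : Fin (L.arF f) → Str L} {U' : Fin (L.arG g) → Str L} :
      Seq.ResFree ⟨.opF f U, .opG g U'⟩ →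
      (∀ i, DLEr (Seq.dir (L.epsF f i) (U i) (botPow (L.epsF f i)))) →
      (∀ i, DLEr (Seq.dir (L.epsG g i) (topPow (L.epsG g i)) (U' i))) →
      DLEr ⟨.opF f U, .opG g U'⟩
  -- logical rules for F and G
  | gBot (g : L.G) (A : Fin (L.arG g) → Fm L) : DLEr ⟨.fm (.opG g A), .checkBot⟩
  | gAtom (g : L.G) (A : Fin (L.arG g) → Fm L) (p : L.AtProp) :
      DLEr ⟨.fm (.opG g A), .fm (.atom p)⟩
  | atomF (p : L.AtProp) (f : L.F) (A : Fin (L.arF f) → Fm L) :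
      DLEr ⟨.fm (.atom p), .fm (.opF f A)⟩
  | topF (f : L.F) (A : Fin (L.arF f) → Fm L) : DLEr ⟨.hatTop, .fm (.opF f A)⟩
  | fL {f : L.F} {A : Fin (L.arF f) → Fm L} {Y : Str L} :
      DLEr ⟨.opF f (fun i => .fm (A i)), Y⟩ → DLEr ⟨.fm (.opF f A), Y⟩
  | gf (g : L.G) (B : Fin (L.arG g) → Fm L) (f : L.F) (A : Fin (L.arF f) → Fm L) :
      DLEr ⟨.fm (.opG g B), .fm (.opF f A)⟩
  | gR {g : L.G} {A : Fin (L.arG g) → Fm L} {X : Str L} :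
      DLEr ⟨X, .opG g (fun i => .fm (A i))⟩ → DLEr ⟨X, .fm (.opG g A)⟩
  | fR {f : L.F} {U : Fin (L.arF f) → Str L} {A : Fin (L.arF f) → Fm L} (j : Fin (L.arF f)) :
      Seq.ResFree ⟨.opF f U, .fm (.opF f A)⟩ →
      (∀ i, DLEr (Seq.dir (L.epsF f i) (U i) (botPow (L.epsF f i)))) →
      DLEr (Seq.dir (L.epsF f j) (U j) (.fm (A j))) →
      DLEr ⟨.opF f U, .fm (.opF f A)⟩
  | gL {g : L.G} {A : Fin (L.arG g) → Fm L} {U : Fin (L.arG g) → Str L} (j : Fin (L.arG g)) :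
      Seq.ResFree ⟨.fm (.opG g A), .opG g U⟩ →
      (∀ i, DLEr (Seq.dir (L.epsG g i) (topPow (L.epsG g i)) (U i))) →
      DLEr (Seq.dir (L.epsG g j) (.fm (A j)) (U j)) →
      DLEr ⟨.fm (.opG g A), .opG g U⟩
  | gLne {g₁ g₂ : L.G} {A : Fin (L.arG g₁) → Fm L} {U : Fin (L.arG g₂) → Str L} :
      g₁ ≠ g₂ → Seq.ResFree ⟨.fm (.opG g₁ A), .opG g₂ U⟩ →
      (∀ i, DLEr (Seq.dir (L.epsG g₂ i) (topPow (L.epsG g₂ i)) (U i))) →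
      DLEr ⟨.fm (.opG g₁ A), .opG g₂ U⟩
  | fRne {f₁ f₂ : L.F} {U : Fin (L.arF f₁) → Str L} {A : Fin (L.arF f₂) → Fm L} :
      f₁ ≠ f₂ → Seq.ResFree ⟨.opF f₁ U, .fm (.opF f₂ A)⟩ →
      (∀ i, DLEr (Seq.dir (L.epsF f₁ i) (U i) (botPow (L.epsF f₁ i)))) →
      DLEr ⟨.opF f₁ U, .fm (.opF f₂ A)⟩
  -- lattice connectives
  | topL {Y : Str L} : DLEr ⟨.hatTop, Y⟩ → DLEr ⟨.fm .top, Y⟩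
  | orL1 {A B : Fm L} {Y : Str L} : DLEr ⟨.fm A, Y⟩ → DLEr ⟨.fm (.or A B), Y⟩
  | orL2 {A B : Fm L} {Y : Str L} : DLEr ⟨.fm B, Y⟩ → DLEr ⟨.fm (.or A B), Y⟩
  | andR1 {X : Str L} {A B : Fm L} : DLEr ⟨X, .fm A⟩ → DLEr ⟨X, .fm (.and A B)⟩
  | andR2 {X : Str L} {A B : Fm L} : DLEr ⟨X, .fm B⟩ → DLEr ⟨X, .fm (.and A B)⟩
  | botR {X : Str L} : DLEr ⟨X, .checkBot⟩ → DLEr ⟨X, .fm .bot⟩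
  -- The next two rules have one pair of premises for every occurrence of a conjunction as a
  -- substructure in precedent position, and of a disjunction as a substructure in succedent
  -- position, of the side structure.
  | andL {A B : Fm L} {Y : Str L} :
      ¬ Y.Branching .neg → Seq.ResFree ⟨.fm (.and A B), Y⟩ →
      DLEr ⟨.fm A, Y⟩ → DLEr ⟨.fm B, Y⟩ →
      (∀ C D Z, Repl .pos (.fm (.and C D)) (.fm C) .neg Y Z → DLEr ⟨.fm (.and A B), Z⟩) →
      (∀ C D Z, Repl .pos (.fm (.and C D)) (.fm D) .neg Y Z → DLEr ⟨.fm (.and A B), Z⟩) →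
      (∀ C D Z, Repl .neg (.fm (.or C D)) (.fm C) .neg Y Z → DLEr ⟨.fm (.and A B), Z⟩) →
      (∀ C D Z, Repl .neg (.fm (.or C D)) (.fm D) .neg Y Z → DLEr ⟨.fm (.and A B), Z⟩) →
      DLEr ⟨.fm (.and A B), Y⟩
  | orR {X : Str L} {A B : Fm L} :
      ¬ X.Branching .pos → Seq.ResFree ⟨X, .fm (.or A B)⟩ →
      DLEr ⟨X, .fm A⟩ → DLEr ⟨X, .fm B⟩ →
      (∀ C D Z, Repl .pos (.fm (.and C D)) (.fm C) .pos X Z → DLEr ⟨Z, .fm (.or A B)⟩) →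
      (∀ C D Z, Repl .pos (.fm (.and C D)) (.fm D) .pos X Z → DLEr ⟨Z, .fm (.or A B)⟩) →
      (∀ C D Z, Repl .neg (.fm (.or C D)) (.fm C) .pos X Z → DLEr ⟨Z, .fm (.or A B)⟩) →
      (∀ C D Z, Repl .neg (.fm (.or C D)) (.fm D) .pos X Z → DLEr ⟨Z, .fm (.or A B)⟩) →
      DLEr ⟨X, .fm (.or A B)⟩

end LEDisplay

namespace LEDisplay

variable {L : Sig}

/-! The proof is by strong induction on the weight of the underivable residual-free sequent.
Derivations in D.LE are never analysed and cut is not used: every step applies a rule of D.LE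
contrapositively, so that an underivable conclusion yields an underivable premise.

If some formula below the structural connectives is not normal, it is displayed (`IsCtx.display`),
replaced by a lighter structure (`Fm.exists_reduct`) and put back in its context. The displayed side
`W` does not depend on the content of the hole and is the same for both calculi, so underivability
passes to the lighter sequent and refutability passes back.

If both sides are normal, the pair of outermost connectives selects a rule of D.LE^r
(`CompleteBelow.refute_normal`). Its premises are lighter, and underivable by weakening under
display (`DLE.of_arg_bot`, `DLE.of_arg_top`) or by the logical rules of D.LE; normality gives the
non-branching side condition of the rules `andL` and `orR`. -/

theorem Sgn.dual_dual (s : Sgn) : s.dual.dual = s := by cases s <;> rfl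

theorem Seq.dir_dual (s : Sgn) (X Y : Str L) : Seq.dir s.dual X Y = Seq.dir s Y X := by
  cases s <;> rfl

/-! ### Weights -/

/-- The weight of a formula; `F`- and `G`-connectives weigh more than their structural versions. -/
def Fm.weight : Fm L → ℕ
  | .atom _ => 1
  | .bot => 2
  | .top => 2
  | .and A B => A.weight + B.weight + 1
  | .or A B => A.weight + B.weight + 1
  | .opF _ a => (∑ i, (a i).weight) + 2
  | .opG _ a => (∑ i, (a i).weight) + 2

/-- The weight of a structure without residuals. -/
def Str.weight : Str L → ℕ
  | .fm A => A.weight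
  | .hatTop => 1
  | .checkBot => 1
  | .opF _ a => (∑ i, (a i).weight) + 1
  | .opG _ a => (∑ i, (a i).weight) + 1
  | .sharp _ _ _ => 1
  | .flat _ _ _ => 1

theorem Fm.weight_pos (A : Fm L) : 0 < A.weight := by
  cases A <;> simp [Fm.weight]

theorem Str.weight_pos (X : Str L) : 0 < X.weight := by
  cases X <;> simp [Str.weight, Fm.weight_pos]

/-! ### Contexts and the display property -/

/-- `IsCtx t s C`: the function `C` fills a hole in position `t` of a well-sorted residual-free
structure in position `s`. -/
inductive IsCtx (t : Sgn) : Sgn → (Str L → Str L) → Prop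
  | hole : IsCtx t t id
  | opF {f : L.F} {a : Fin (L.arF f) → Str L} {C : Str L → Str L} (i : Fin (L.arF f)) :
      (∀ j, (a j).IsAt (L.epsF f j)) → (∀ j, (a j).ResFree) → IsCtx t (L.epsF f i) C →
      IsCtx t .pos (fun U => .opF f (Function.update a i (C U)))
  | opG {g : L.G} {a : Fin (L.arG g) → Str L} {C : Str L → Str L} (i : Fin (L.arG g)) :
      (∀ j, (a j).IsAt (L.epsG g j).dual) → (∀ j, (a j).ResFree) →
      IsCtx t (L.epsG g i).dual C →
      IsCtx t .neg (fun U => .opG g (Function.update a i (C U)))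

theorem sum_update_lt {n : ℕ} (a : Fin n → Str L) (i : Fin n) {V U : Str L}
    (h : V.weight < U.weight) :
    ∑ j, (Function.update a i V j).weight < ∑ j, (Function.update a i U j).weight := by
  refine Finset.sum_lt_sum (fun j _ => ?_) ⟨i, Finset.mem_univ _, by simpa using h⟩
  rcases eq_or_ne j i with rfl | hj
  · simpa using h.le
  · simp [hj]

namespace IsCtx

variable {t s : Sgn} {C : Str L → Str L}

theorem weight_lt (h : IsCtx t s C) {U V : Str L} (hw : V.weight < U.weight) :
    (C V).weight < (C U).weight := by
  induction h with
  | hole => exact hw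
  | opF i _ _ _ ih => simpa [Str.weight] using sum_update_lt _ i ih
  | opG i _ _ _ ih => simpa [Str.weight] using sum_update_lt _ i ih

theorem isAt (h : IsCtx t s C) {V : Str L} (hV : V.IsAt t) : (C V).IsAt s := by
  induction h with
  | hole => exact hV
  | opF i ha _ _ ih =>
    refine ⟨rfl, fun j => ?_⟩
    rcases eq_or_ne j i with rfl | hj
    · simpa [Sgn.mul] using ih
    · simpa [hj, Sgn.mul] using ha j
  | opG i ha _ _ ih =>
    refine ⟨rfl, fun j => ?_⟩
    rcases eq_or_ne j i with rfl | hj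
    · simpa [Sgn.mul] using ih
    · simpa [hj, Sgn.mul] using ha j

theorem resFree (h : IsCtx t s C) {V : Str L} (hV : V.ResFree) : (C V).ResFree := by
  induction h with
  | hole => exact hV
  | opF i _ hr _ ih =>
    intro j
    rcases eq_or_ne j i with rfl | hj
    · simpa using ih
    · simpa [hj] using hr j
  | opG i _ hr _ ih =>
    intro j
    rcases eq_or_ne j i with rfl | hj
    · simpa using ih
    · simpa [hj] using hr j

end IsCtx

/-- The weakening rules of D.LE demand well-sorted structures, so the sort of the residual produced
by displaying has to be tracked. The proof is sign arithmetic. -/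
theorem sharp_isAt {f : L.F} {a : Fin (L.arF f) → Str L} (ha : ∀ j, (a j).IsAt (L.epsF f j))
    (i : Fin (L.arF f)) {Y : Str L} (hY : Y.IsAt .neg) :
    (Str.sharp f i (Function.update a i Y)).IsAt (L.epsF f i).dual := by
  refine ⟨rfl, fun j => ?_⟩
  rcases eq_or_ne j i with rfl | hj
  · have : (L.epsF f j).dual.mul (L.epsF f j) = .neg := by cases L.epsF f j <;> rfl
    simpa [Sig.epsSharp, this] using hY
  · have : (L.epsF f i).dual.mul ((L.epsF f j).mul (L.epsF f i).dual) = L.epsF f j := by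
      cases L.epsF f j <;> cases L.epsF f i <;> rfl
    simpa [Sig.epsSharp, this, hj] using ha j

theorem flat_isAt {g : L.G} {a : Fin (L.arG g) → Str L}
    (ha : ∀ j, (a j).IsAt (L.epsG g j).dual)
    (i : Fin (L.arG g)) {X : Str L} (hX : X.IsAt .pos) :
    (Str.flat g i (Function.update a i X)).IsAt (L.epsG g i) := by
  refine ⟨rfl, fun j => ?_⟩
  rcases eq_or_ne j i with rfl | hj
  · have : (L.epsG g j).mul (L.epsG g j) = .pos := by cases L.epsG g j <;> rfl
    simpa [Sig.epsFlat, this] using hX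
  · have : (L.epsG g i).mul ((L.epsG g j).mul (L.epsG g i).dual) = (L.epsG g j).dual := by
      cases L.epsG g j <;> cases L.epsG g i <;> rfl
    simpa [Sig.epsFlat, this, hj] using ha j

/-- Read at `Function.update a i _`, the two display rules are mutually inverse, because a second
update at `i` forgets the first. -/
theorem DLE.display_opF {f : L.F} (a : Fin (L.arF f) → Str L) (i : Fin (L.arF f)) (U Y : Str L) :
    DLE ⟨.opF f (Function.update a i U), Y⟩ ↔
      DLE (Seq.dir (L.epsF f i) U (.sharp f i (Function.update a i Y))) := by
  constructor
  · intro h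
    simpa using h.dispF i
  · intro h
    simpa using h.undispF

theorem DLE.display_opG {g : L.G} (a : Fin (L.arG g) → Str L) (i : Fin (L.arG g)) (U X : Str L) :
    DLE ⟨X, .opG g (Function.update a i U)⟩ ↔
      DLE (Seq.dir (L.epsG g i) (.flat g i (Function.update a i X)) U) := by
  constructor
  · intro h
    simpa using h.dispG i
  · intro h
    simpa using h.undispG

theorem DLEr.display_opF {f : L.F} (a : Fin (L.arF f) → Str L) (i : Fin (L.arF f)) (U Y : Str L) :
    DLEr ⟨.opF f (Function.update a i U), Y⟩ ↔
      DLEr (Seq.dir (L.epsF f i) U (.sharp f i (Function.update a i Y))) := by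
  constructor
  · intro h
    simpa using h.dispF i
  · intro h
    simpa using h.undispF

theorem DLEr.display_opG {g : L.G} (a : Fin (L.arG g) → Str L) (i : Fin (L.arG g)) (U X : Str L) :
    DLEr ⟨X, .opG g (Function.update a i U)⟩ ↔
      DLEr (Seq.dir (L.epsG g i) (.flat g i (Function.update a i X)) U) := by
  constructor
  · intro h
    simpa using h.dispG i
  · intro h
    simpa using h.undispG

/-- Display property: the hole of a context can be displayed, in both calculi at once. -/
theorem IsCtx.display {t s : Sgn} {C : Str L → Str L} (h : IsCtx t s C) :
    ∀ Y : Str L, Y.IsAt s.dual → ∃ W : Str L, W.IsAt t.dual ∧ ∀ U,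
      (DLE (Seq.dir s (C U) Y) ↔ DLE (Seq.dir t U W)) ∧
      (DLEr (Seq.dir s (C U) Y) ↔ DLEr (Seq.dir t U W)) := by
  induction h with
  | hole => exact fun Y hY => ⟨Y, hY, fun U => ⟨Iff.rfl, Iff.rfl⟩⟩
  | opF i ha _ _ ih =>
    intro Y hY
    -- The outermost connective moves across as its residual, which becomes the other side for the
    -- inner context.
    obtain ⟨W, hW, h⟩ := ih _ (sharp_isAt ha i hY)
    exact ⟨W, hW, fun U => ⟨(DLE.display_opF _ i _ Y).trans (h U).1,
      (DLEr.display_opF _ i _ Y).trans (h U).2⟩⟩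
  | opG i ha _ _ ih =>
    intro X hX
    obtain ⟨W, hW, h⟩ := ih _ (by rw [Sgn.dual_dual]; exact flat_isAt ha i hX)
    -- The inner context stands in position `(L.epsG g i).dual`, whereas the display rule is phrased
    -- with `L.epsG g i`.
    simp only [Seq.dir_dual] at h
    exact ⟨W, hW, fun U => ⟨(DLE.display_opG _ i _ X).trans (h U).1,
      (DLEr.display_opG _ i _ X).trans (h U).2⟩⟩

/-- Turns the replacements in the rules `andL` and `orR` into contexts, so that the display property
applies to them. -/
theorem Repl.exists_ctx {t s : Sgn} {U V X Z : Str L} (h : Repl t U V s X Z) (hX : X.IsAt s)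
    (hr : X.ResFree) : ∃ C, IsCtx t s C ∧ C U = X ∧ C V = Z := by
  induction h with
  | here => exact ⟨id, .hole, rfl, rfl⟩
  | @opF s f a Z i _ ih =>
    obtain ⟨rfl, ha⟩ := hX
    obtain ⟨C, hC, hU, hV⟩ := ih (ha i) (hr i)
    exact ⟨_, .opF i ha hr hC, by simp [hU], by simp [hV]⟩
  | @opG s g a Z i _ ih =>
    obtain ⟨rfl, ha⟩ := hX
    obtain ⟨C, hC, hU, hV⟩ := ih (ha i) (hr i)
    exact ⟨_, .opG i ha hr hC, by simp [hU], by simp [hV]⟩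
  | sharp => exact hr.elim
  | flat => exact hr.elim

/-! ### Normal structures and reduction of the others -/

/-- Formulas in position `s` that no invertible rule decomposes. -/
def Fm.Normal : Sgn → Fm L → Prop
  | _, .atom _ => True
  | _, .bot => False
  | _, .top => False
  | s, .and _ _ => s = .pos
  | s, .or _ _ => s = .neg
  | s, .opF _ _ => s = .neg
  | s, .opG _ _ => s = .pos

/-- Structures in position `s` to which no invertible rule applies. -/
def Str.Normal : Sgn → Str L → Prop
  | s, .fm A => A.Normal s
  | _, .hatTop => True
  | _, .checkBot => True
  | s, .opF f a => ∀ i, (a i).Normal (s.mul (L.epsF f i))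
  | s, .opG g a => ∀ i, (a i).Normal (s.mul (L.epsG g i))
  | _, .sharp _ _ _ => True
  | _, .flat _ _ _ => True

/-- A normal formula is never a `+∨` or `-∧` node, and its root (`+∧`, `-∨`, `-f`, `+g` or an atom)
blocks every path leading deeper. -/
theorem Str.Normal.not_branching {s : Sgn} {X : Str L} (h : X.Normal s) : ¬ X.Branching s := by
  induction X generalizing s with
  | fm A => cases A <;> cases s <;> simp_all [Str.Normal, Fm.Normal, Str.Branching, Fm.Branching]
  | hatTop => exact id
  | checkBot => exact id
  | opF f a ih => exact fun ⟨_, i, hi⟩ => ih i (h i) hi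
  | opG g a ih => exact fun ⟨_, i, hi⟩ => ih i (h i) hi
  | sharp => exact id
  | flat => exact id

theorem Str.normal_or_exists_ctx {s : Sgn} {X : Str L} (hX : X.IsAt s) (hr : X.ResFree) :
    X.Normal s ∨ ∃ t C A, IsCtx t s C ∧ C (.fm A) = X ∧ ¬ A.Normal t := by
  induction X generalizing s with
  | fm A =>
    by_cases h : A.Normal s
    · exact .inl h
    · exact .inr ⟨s, id, A, .hole, rfl, h⟩
  | hatTop => exact .inl trivial
  | checkBot => exact .inl trivial
  | opF f a ih =>
    obtain ⟨rfl, ha⟩ := hX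
    by_cases h : ∀ i, (a i).Normal (Sgn.pos.mul (L.epsF f i))
    · exact .inl h
    · obtain ⟨i, hi⟩ := not_forall.1 h
      obtain ⟨t, C, A, hC, hA, hn⟩ := (ih i (ha i) (hr i)).resolve_left hi
      exact .inr ⟨t, _, A, .opF i ha hr hC, by simp [hA], hn⟩
  | opG g a ih =>
    obtain ⟨rfl, ha⟩ := hX
    by_cases h : ∀ i, (a i).Normal (Sgn.neg.mul (L.epsG g i))
    · exact .inl h
    · obtain ⟨i, hi⟩ := not_forall.1 h
      obtain ⟨t, C, A, hC, hA, hn⟩ := (ih i (ha i) (hr i)).resolve_left hi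
      exact .inr ⟨t, _, A, .opG i ha hr hC, by simp [hA], hn⟩
  | sharp => exact hr.elim
  | flat => exact hr.elim

/-- A displayed formula that is not normal can be replaced by a lighter structure, preserving
underivability and reflecting refutability. -/
theorem Fm.exists_reduct {t : Sgn} {A : Fm L} (hA : ¬ A.Normal t) {W : Str L} (hW : W.IsAt t.dual)
    (h : ¬ DLE (Seq.dir t (.fm A) W)) :
    ∃ V : Str L, V.weight < A.weight ∧ V.IsAt t ∧ V.ResFree ∧ ¬ DLE (Seq.dir t V W) ∧
      (DLEr (Seq.dir t V W) → DLEr (Seq.dir t (.fm A) W)) := by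
  cases t with
  | pos =>
    cases A with
    | atom p => exact (hA trivial).elim
    -- The sequent would be derivable by weakening, whatever `W` is.
    | bot => exact (h (.botW hW .botL)).elim
    | top => exact ⟨.hatTop, by simp [Str.weight, Fm.weight], rfl, trivial,
        fun d => h (.topL d), .topL⟩
    | and A B => exact (hA rfl).elim
    | or A B =>
      -- Derivability of both disjuncts would derive the disjunction, so one of them is an
      -- underivable reduct.
      by_cases d : DLE ⟨.fm A, W⟩
      · exact ⟨.fm B, by simp [Str.weight, Fm.weight], trivial, trivial,
          fun d' => h (.orL d d'), .orL2⟩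
      · exact ⟨.fm A, by simp [Str.weight, Fm.weight], trivial, trivial, d, .orL1⟩
    | opF f a => exact ⟨.opF f fun i => .fm (a i), by simp [Str.weight, Fm.weight],
        ⟨rfl, fun _ => trivial⟩, fun _ => trivial, fun d => h (.fL d), .fL⟩
    | opG g a => exact (hA rfl).elim
  | neg =>
    cases A with
    | atom p => exact (hA trivial).elim
    | bot => exact ⟨.checkBot, by simp [Str.weight, Fm.weight], rfl, trivial,
        fun d => h (.botR d), .botR⟩
    | top => exact (h (.topW hW .topR)).elim
    | and A B =>
      by_cases d : DLE ⟨W, .fm A⟩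
      · exact ⟨.fm B, by simp [Str.weight, Fm.weight], trivial, trivial,
          fun d' => h (.andR d d'), .andR2⟩
      · exact ⟨.fm A, by simp [Str.weight, Fm.weight], trivial, trivial, d, .andR1⟩
    | or A B => exact (hA rfl).elim
    | opF f a => exact (hA rfl).elim
    | opG g a => exact ⟨.opG g fun i => .fm (a i), by simp [Str.weight, Fm.weight],
        ⟨rfl, fun _ => trivial⟩, fun _ => trivial, fun d => h (.gR d), .gR⟩

/-! ### The induction step -/

/-- The induction hypothesis of the completeness proof: underivable residual-free sequents of
weight less than `n` are refutable. -/
def CompleteBelow (L : Sig) (n : ℕ) : Prop :=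
  ∀ (s : Sgn) (X Y : Str L), X.IsAt s → Y.IsAt s.dual → X.ResFree → Y.ResFree →
    X.weight + Y.weight < n → ¬ DLE (Seq.dir s X Y) → DLEr (Seq.dir s X Y)

theorem CompleteBelow.refute_of_ctx {n : ℕ} (H : CompleteBelow L n) {s t : Sgn}
    {C : Str L → Str L} (hC : IsCtx t s C) {A : Fm L} (hA : ¬ A.Normal t) {Y : Str L}
    (hY : Y.IsAt s.dual) (hYr : Y.ResFree) (hn : (C (.fm A)).weight + Y.weight ≤ n)
    (h : ¬ DLE (Seq.dir s (C (.fm A)) Y)) : DLEr (Seq.dir s (C (.fm A)) Y) := by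
  obtain ⟨W, hW, hd⟩ := hC.display Y hY
  rw [(hd _).1] at h
  obtain ⟨V, hw, hV, hVr, hVd, hVA⟩ := Fm.exists_reduct hA hW h
  have hlt := hC.weight_lt (U := .fm A) (V := V) hw
  rw [(hd _).2]
  refine hVA ((hd V).2.1 (H s _ _ (hC.isAt hV) hY (hC.resFree hVr) hYr (by omega) ?_))
  rwa [(hd V).1]

/-- If some argument of a structural `f` entails the falsum, the structure entails everything. -/
theorem DLE.of_arg_bot {f : L.F} {U : Fin (L.arF f) → Str L} {Y : Str L}
    (hU : ∀ j, (U j).IsAt (L.epsF f j)) (hY : Y.IsAt .neg) (i : Fin (L.arF f))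
    (h : DLE (Seq.dir (L.epsF f i) (U i) (botPow (L.epsF f i)))) : DLE ⟨.opF f U, Y⟩ := by
  have hs := sharp_isAt hU i hY
  -- With argument `i` displayed, the goal is a weakening of `h` by the residual, on the side given
  -- by the order-type.
  rw [← Function.update_eq_self i U, DLE.display_opF]
  revert h hs
  cases L.epsF f i
  · exact fun h hs => .botW hs h
  · exact fun h hs => .topW hs h

theorem DLE.of_arg_top {g : L.G} {U : Fin (L.arG g) → Str L} {X : Str L}
    (hU : ∀ j, (U j).IsAt (L.epsG g j).dual) (hX : X.IsAt .pos) (i : Fin (L.arG g))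
    (h : DLE (Seq.dir (L.epsG g i) (topPow (L.epsG g i)) (U i))) : DLE ⟨X, .opG g U⟩ := by
  have hs := flat_isAt hU i hX
  rw [← Function.update_eq_self i U, DLE.display_opG]
  revert h hs
  cases L.epsG g i
  · exact fun h hs => .topW hs h
  · exact fun h hs => .botW hs h

theorem weight_le_sum {n : ℕ} (U : Fin n → Str L) (i : Fin n) :
    (U i).weight ≤ ∑ j, (U j).weight :=
  Finset.single_le_sum (f := fun j => (U j).weight) (fun _ _ => Nat.zero_le _) (Finset.mem_univ i)

theorem fm_weight_le_sum {n : ℕ} (A : Fin n → Fm L) (i : Fin n) :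
    (A i).weight ≤ ∑ j, (A j).weight :=
  Finset.single_le_sum (f := fun j => (A j).weight) (fun _ _ => Nat.zero_le _) (Finset.mem_univ i)

theorem botPow_isAt (s : Sgn) : (botPow s : Str L).IsAt s.dual := by cases s <;> rfl
theorem topPow_isAt (s : Sgn) : (topPow s : Str L).IsAt s := by cases s <;> rfl
theorem botPow_resFree (s : Sgn) : (botPow s : Str L).ResFree := by cases s <;> trivial
theorem topPow_resFree (s : Sgn) : (topPow s : Str L).ResFree := by cases s <;> trivial
theorem botPow_weight (s : Sgn) : (botPow s : Str L).weight = 1 := by cases s <;> rfl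
theorem topPow_weight (s : Sgn) : (topPow s : Str L).weight = 1 := by cases s <;> rfl

namespace CompleteBelow

variable {n : ℕ}

/-- Supplies the premises shared by all rules for a structural `f`. The discarded `Y` weighs at
least as much as the constant replacing it, and losing `f` makes the decrease strict. -/
theorem refute_args_opF (H : CompleteBelow L n) {f : L.F} {U : Fin (L.arF f) → Str L} {Y : Str L}
    (hU : (Str.opF f U).IsAt .pos) (hUr : (Str.opF f U).ResFree) (hY : Y.IsAt .neg)
    (hn : (Str.opF f U).weight + Y.weight ≤ n) (h : ¬ DLE ⟨.opF f U, Y⟩) (i : Fin (L.arF f)) :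
    DLEr (Seq.dir (L.epsF f i) (U i) (botPow (L.epsF f i))) := by
  refine H _ _ _ (hU.2 i) (botPow_isAt _) (hUr i) (botPow_resFree _) ?_
    fun d => h (.of_arg_bot hU.2 hY i d)
  have := weight_le_sum U i
  have := Y.weight_pos
  simp only [Str.weight, botPow_weight] at *
  omega

theorem refute_args_opG (H : CompleteBelow L n) {g : L.G} {U : Fin (L.arG g) → Str L} {X : Str L}
    (hU : (Str.opG g U).IsAt .neg) (hUr : (Str.opG g U).ResFree) (hX : X.IsAt .pos)
    (hn : X.weight + (Str.opG g U).weight ≤ n) (h : ¬ DLE ⟨X, .opG g U⟩) (i : Fin (L.arG g)) :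
    DLEr (Seq.dir (L.epsG g i) (topPow (L.epsG g i)) (U i)) := by
  refine H _ _ _ (topPow_isAt _) (hU.2 i) (topPow_resFree _) (hUr i) ?_
    fun d => h (.of_arg_top hU.2 hX i d)
  have := weight_le_sum U i
  have := X.weight_pos
  simp only [Str.weight, topPow_weight] at *
  omega

/-- Refutability of all antisequents obtained by a replacement on the side `s` which is sound on
displayed formulas. -/
theorem refute_repl (H : CompleteBelow L n) {s t : Sgn} {A B : Fm L} {X Z Y : Str L}
    (hX : X.IsAt s) (hXr : X.ResFree) (hY : Y.IsAt s.dual) (hYr : Y.ResFree)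
    (hn : X.weight + Y.weight ≤ n) (h : ¬ DLE (Seq.dir s X Y)) (hw : B.weight < A.weight)
    (hAB : ∀ W : Str L, DLE (Seq.dir t (.fm B) W) → DLE (Seq.dir t (.fm A) W))
    (hZ : Repl t (.fm A) (.fm B) s X Z) : DLEr (Seq.dir s Z Y) := by
  obtain ⟨C, hC, rfl, rfl⟩ := hZ.exists_ctx hX hXr
  -- One `W` serves both `A` and `B`, so `hAB` carries over to the whole context.
  obtain ⟨W, -, hd⟩ := hC.display Y hY
  have hlt := hC.weight_lt (U := .fm A) (V := .fm B) hw
  refine H s _ _ (hC.isAt trivial) hY (hC.resFree trivial) hYr (by omega) fun d => h ?_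
  exact (hd _).1.2 (hAB W ((hd _).1.1 d))

theorem refute_andL (H : CompleteBelow L n) {A B : Fm L} {Y : Str L}
    (hY : Y.IsAt .neg) (hYr : Y.ResFree) (hN : Y.Normal .neg)
    (hn : (Fm.and A B).weight + Y.weight ≤ n) (h : ¬ DLE ⟨.fm (.and A B), Y⟩) :
    DLEr ⟨.fm (.and A B), Y⟩ := by
  have hn' : Y.weight + (Str.fm (Fm.and A B)).weight ≤ n := by
    simp only [Str.weight]; omega
  have h1 : A.weight + Y.weight < n := by simp only [Fm.weight] at hn; omega
  have h2 : B.weight + Y.weight < n := by simp only [Fm.weight] at hn; omega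
  refine .andL hN.not_branching ⟨trivial, hYr⟩
    (H .pos _ _ trivial hY trivial hYr h1 fun d => h (.andL1 d))
    (H .pos _ _ trivial hY trivial hYr h2 fun d => h (.andL2 d)) ?_ ?_ ?_ ?_ <;>
    intro C D Z hZ
  · exact H.refute_repl (s := .neg) hY hYr trivial trivial hn' h (by simp [Fm.weight])
      (fun _ d => .andL1 d) hZ
  · exact H.refute_repl (s := .neg) hY hYr trivial trivial hn' h (by simp [Fm.weight])
      (fun _ d => .andL2 d) hZ
  · exact H.refute_repl (s := .neg) hY hYr trivial trivial hn' h (by simp [Fm.weight])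
      (fun _ d => .orR1 d) hZ
  · exact H.refute_repl (s := .neg) hY hYr trivial trivial hn' h (by simp [Fm.weight])
      (fun _ d => .orR2 d) hZ

theorem refute_orR (H : CompleteBelow L n) {A B : Fm L} {X : Str L}
    (hX : X.IsAt .pos) (hXr : X.ResFree) (hN : X.Normal .pos)
    (hn : X.weight + (Fm.or A B).weight ≤ n) (h : ¬ DLE ⟨X, .fm (.or A B)⟩) :
    DLEr ⟨X, .fm (.or A B)⟩ := by
  have h1 : X.weight + A.weight < n := by simp only [Fm.weight] at hn; omega
  have h2 : X.weight + B.weight < n := by simp only [Fm.weight] at hn; omega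
  refine .orR hN.not_branching ⟨hXr, trivial⟩
    (H .pos _ _ hX trivial hXr trivial h1 fun d => h (.orR1 d))
    (H .pos _ _ hX trivial hXr trivial h2 fun d => h (.orR2 d)) ?_ ?_ ?_ ?_ <;>
    intro C D Z hZ
  · exact H.refute_repl (s := .pos) hX hXr trivial trivial hn h (by simp [Fm.weight])
      (fun _ d => .andL1 d) hZ
  · exact H.refute_repl (s := .pos) hX hXr trivial trivial hn h (by simp [Fm.weight])
      (fun _ d => .andL2 d) hZ
  · exact H.refute_repl (s := .pos) hX hXr trivial trivial hn h (by simp [Fm.weight])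
      (fun _ d => .orR1 d) hZ
  · exact H.refute_repl (s := .pos) hX hXr trivial trivial hn h (by simp [Fm.weight])
      (fun _ d => .orR2 d) hZ

theorem refute_opF_fm (H : CompleteBelow L n) {f f' : L.F} {U : Fin (L.arF f) → Str L}
    {A : Fin (L.arF f') → Fm L} (hU : (Str.opF f U).IsAt .pos) (hUr : (Str.opF f U).ResFree)
    (hn : (Str.opF f U).weight + (Fm.opF f' A).weight ≤ n)
    (h : ¬ DLE ⟨.opF f U, .fm (.opF f' A)⟩) : DLEr ⟨.opF f U, .fm (.opF f' A)⟩ := by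
  have hB := H.refute_args_opF (Y := .fm (.opF f' A)) hU hUr trivial hn h
  rcases eq_or_ne f f' with rfl | hne
  · obtain ⟨j, hj⟩ := not_forall.1 fun d => h (.fR d)
    refine .fR j ⟨hUr, trivial⟩ hB (H _ _ _ (hU.2 j) trivial (hUr j) trivial ?_ hj)
    have := weight_le_sum U j
    have := fm_weight_le_sum A j
    simp only [Str.weight, Fm.weight] at *
    omega
  · exact .fRne hne ⟨hUr, trivial⟩ hB

theorem refute_fm_opG (H : CompleteBelow L n) {g g' : L.G} {U : Fin (L.arG g) → Str L}
    {A : Fin (L.arG g') → Fm L} (hU : (Str.opG g U).IsAt .neg) (hUr : (Str.opG g U).ResFree)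
    (hn : (Fm.opG g' A).weight + (Str.opG g U).weight ≤ n)
    (h : ¬ DLE ⟨.fm (.opG g' A), .opG g U⟩) : DLEr ⟨.fm (.opG g' A), .opG g U⟩ := by
  have hT := H.refute_args_opG (X := .fm (.opG g' A)) hU hUr trivial hn h
  rcases eq_or_ne g' g with rfl | hne
  · obtain ⟨j, hj⟩ := not_forall.1 fun d => h (.gL d)
    refine .gL j ⟨trivial, hUr⟩ hT (H _ _ _ trivial (hU.2 j) trivial (hUr j) ?_ hj)
    have := weight_le_sum U j
    have := fm_weight_le_sum A j
    simp only [Str.weight, Fm.weight] at *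
    omega
  · exact .gLne hne ⟨trivial, hUr⟩ hT

theorem refute_normal (H : CompleteBelow L n) {X Y : Str L} (hX : X.IsAt .pos) (hY : Y.IsAt .neg)
    (hXr : X.ResFree) (hYr : Y.ResFree) (hXn : X.Normal .pos) (hYn : Y.Normal .neg)
    (hn : X.weight + Y.weight ≤ n) (h : ¬ DLE ⟨X, Y⟩) : DLEr ⟨X, Y⟩ := by
  match X, Y with
  -- The alternatives up to the first use of `refute_andL` are excluded by sort, residual-freeness
  -- or normality.
  | .checkBot, _ => cases hX
  | .opG _ _, _ => cases hX.1
  | .sharp _ _ _, _ => exact hXr.elim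
  | .flat _ _ _, _ => exact hXr.elim
  | _, .hatTop => cases hY
  | _, .opF _ _ => cases hY.1
  | _, .sharp _ _ _ => exact hYr.elim
  | _, .flat _ _ _ => exact hYr.elim
  | .fm .bot, _ => exact hXn.elim
  | .fm .top, _ => exact hXn.elim
  | .fm (.or _ _), _ => cases hXn
  | .fm (.opF _ _), _ => cases hXn
  | _, .fm .bot => exact hYn.elim
  | _, .fm .top => exact hYn.elim
  | _, .fm (.and _ _) => cases hYn
  | _, .fm (.opG _ _) => cases hYn
  -- When a conjunction faces a disjunction, both this case and the next would apply.
  | .fm (.and A B), Y => exact H.refute_andL hY hYr hYn hn h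
  | X, .fm (.or A B) => exact H.refute_orR hX hXr hXn hn h
  | .hatTop, .checkBot => exact .ax1
  | .hatTop, .fm (.atom q) => exact .ax3 q
  | .hatTop, .fm (.opF f A) => exact .topF f A
  | .hatTop, .opG g U => exact .topG ⟨trivial, hYr⟩ (H.refute_args_opG hY hYr hX hn h)
  | .fm (.atom p), .checkBot => exact .ax2 p
  | .fm (.atom p), .fm (.atom q) =>
    exact .ax4 p q fun e => h (e ▸ .id p)
  | .fm (.atom p), .fm (.opF f A) => exact .atomF p f A
  | .fm (.atom p), .opG g U => exact .atomG p ⟨trivial, hYr⟩ (H.refute_args_opG hY hYr hX hn h)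
  | .fm (.opG g A), .checkBot => exact .gBot g A
  | .fm (.opG g A), .fm (.atom q) => exact .gAtom g A q
  | .fm (.opG g A), .fm (.opF f B) => exact .gf g A f B
  | .fm (.opG g A), .opG g' U => exact H.refute_fm_opG hY hYr hn h
  | .opF f U, .checkBot => exact .fBot ⟨hXr, trivial⟩ (H.refute_args_opF hX hXr hY hn h)
  | .opF f U, .fm (.atom q) => exact .fAtom q ⟨hXr, trivial⟩ (H.refute_args_opF hX hXr hY hn h)
  | .opF f U, .fm (.opF f' A) => exact H.refute_opF_fm hX hXr hn h
  | .opF f U, .opG g U' =>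
    exact .fG ⟨hXr, hYr⟩ (H.refute_args_opF hX hXr hY hn h) (H.refute_args_opG hY hYr hX hn h)

theorem refute (H : CompleteBelow L n) {X Y : Str L} (hX : X.IsAt .pos) (hY : Y.IsAt .neg)
    (hXr : X.ResFree) (hYr : Y.ResFree) (hn : X.weight + Y.weight ≤ n) (h : ¬ DLE ⟨X, Y⟩) :
    DLEr ⟨X, Y⟩ := by
  rcases Str.normal_or_exists_ctx hX hXr with hXn | ⟨t, C, A, hC, rfl, hA⟩
  · rcases Str.normal_or_exists_ctx hY hYr with hYn | ⟨t, C, A, hC, rfl, hA⟩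
    · exact H.refute_normal hX hY hXr hYr hXn hYn hn h
    -- The context is now the succedent, so the precedent `X` plays the part of the other side.
    · exact H.refute_of_ctx hC hA (Y := X) hX hXr (by omega) h
  · exact H.refute_of_ctx hC hA (Y := Y) hY hYr hn h

end CompleteBelow

theorem completeBelow (L : Sig) (n : ℕ) : CompleteBelow L n := by
  induction n with
  | zero => exact fun _ _ _ _ _ _ _ hn => (Nat.not_lt_zero _ hn).elim
  | succ n ih =>
    intro s X Y hX hY hXr hYr hn h
    cases s with
    | pos => exact ih.refute hX hY hXr hYr (by omega) h
    | neg => exact ih.refute hY hX hYr hXr (by omega) h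

end LEDisplay

/-- Completeness of the refutation display calculus for residual-free sequents. -/
theorem theorem2 (L : LEDisplay.Sig) (X Y : LEDisplay.Str L)
    (hX : X.IsAt LEDisplay.Sgn.pos) (hY : Y.IsAt LEDisplay.Sgn.neg)
    (hXr : X.ResFree) (hYr : Y.ResFree)
    (hXY : ¬ LEDisplay.DLE (L := L) ⟨X, Y⟩) :
    LEDisplay.DLEr (L := L) ⟨X, Y⟩ :=
  -- The bound is the weight of the sequent itself, since `refute` allows equality.
  (LEDisplay.completeBelow L _).refute hX hY hXr hYr le_rfl hXY
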